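/- Let $L\ge 2$ and $N\ge 1$ be integers. Write $\boldsymbol x=(x_1,x_2,\dots)$, $\boldsymbol y=(y_1,y_2,\dots)$, $[t]=(t,t^2/2,t^3/3,\dots)$, and $$\delta_t=\sum_{n\ge1}\Bigl(t^n\frac{\partial}{\partial x_n}-t^{-n}\frac{\partial}{\partial y_n}\Bigr),\qquad E=\sum_{n\ge 1}\Bigl(n x_n\frac{\partial}{\partial x_n}-n y_n\frac{\partial}{\partial y_n}\Bigr).$$ For a derivation $v$ let $D_v f\cdot g=(vf)g-f(vg)$ be the Hirota derivative. Function class. Fix $0\le a\le b\le\infty$ and let $A=\{t\in\mathbb C: a<|t|<b\}$. Let $\mathcal T$ be the union, over all real $r,R>0$ with $a<r$, $R<b$, of the weighted $\ell^1$ spaces of pairs $(\boldsymbol x,\boldsymbol y)$ with $\sum_n|x_n|R^{-n}<\infty$ and $\sum_n|y_n|r^{n}<\infty$. Let $\Omega\subset\mathcal T$ be open, i.e. its trace on each of these Banach spaces is open. Call a function on $\Omega$ holomorphic if it is complex Fréchet differentiable on each of these traces. (For $a=0$, $b=\infty$, $\Omega=\mathcal T$ these are the entire functions on the space of all pairs of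 sequences of at most exponential growth, and $A=\mathbb C\setminus\{0\}$.) Let $\tau_{m,n}=\tau_{m,n}(\boldsymbol x,\boldsymbol y)$ $(m,n\in\mathbb Z)$ be holomorphic functions on $\Omega$ which satisfy, for all $m,n$, all $t,s\in A$ (with $t\ne s$ in (c)) and all $(\boldsymbol x,\boldsymbol y)$ such that all the arguments involved lie in $\Omega$, the equations (a) $(t-s)\,\tau_{m,n}(\boldsymbol x-[t]-[s],\boldsymbol y-[t^{-1}]-[s^{-1}])\,\tau_{m+1,n+1}(\boldsymbol x,\boldsymbol y)-t\,\tau_{m,n+1}(\boldsymbol x-[t],\boldsymbol y-[t^{-1}])\,\tau_{m+1,n}(\boldsymbol x-[s],\boldsymbol y-[s^{-1}])+s\,\tau_{m,n+1}(\boldsymbol x-[s],\boldsymbol y-[s^{-1}])\,\tau_{m+1,n}(\boldsymbol x-[t],\boldsymbol y-[t^{-1}])=0$; (b) $(D_{\delta_t}-1)\,\tau_{m,n+1}(\boldsymbol x,\boldsymbol y)\cdot\tau_{m+1,n}(\boldsymbol x,\boldsymbol y)+\tau_{m,n}(\boldsymbol x-[t],\boldsymbol y-[t^{-1}])\,\tau_{m+1,n+1}(\boldsymbol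 x+[t],\boldsymbol y+[t^{-1}])=0$; (c) $\bigl(D_{\delta_t}+\frac{t}{s-t}\bigr)\tau_{m,n}(\boldsymbol x-[s],\boldsymbol y-[s^{-1}])\cdot\tau_{m+1,n}(\boldsymbol x,\boldsymbol y)+\frac{t}{t-s}\,\tau_{m,n}(\boldsymbol x-[t],\boldsymbol y-[t^{-1}])\,\tau_{m+1,n}(\boldsymbol x+[t]-[s],\boldsymbol y+[t^{-1}]-[s^{-1}])=0$. Suppose moreover that on $\Omega$ they are homogeneous, $E\tau_{m,n}=d_{m,n}\tau_{m,n}$ with $d_{m,n}\in\mathbb C$, and periodic, $\tau_{m+L,n}=\tau_{m,n+L}=\tau_{m,n}$ up to multiplication by nonzero constants. For $\boldsymbol\theta=(\theta_0,\dots,\theta_N)\in\mathbb C^{N+1}$ and $\boldsymbol t=(t_0,\dots,t_N)\in A^{N+1}$ set $\sigma_{m,n}(\boldsymbol\theta,\boldsymbol t)=\tau_{m,n}(\boldsymbol x,\boldsymbol y)$ under the substitution $$x_n=\frac1n\sum_{i=0}^N\theta_i t_i^n,\qquad y_n=\frac1n\sum_{i=0}^N\theta_i t_i^{-n}\qquad(n\ge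 1).$$ Write $\sigma_{m,n}(\theta_i\pm1)$ for $\sigma_{m,n}$ with only the parameter $\theta_i$ shifted by $\pm1$ (similarly for two shifts), and $D_i$ for the Hirota derivative with respect to $\partial/\partial t_i$. Then for all $m,n\in\mathbb Z$ and all $i,j\in\{0,\dots,N\}$, at every $(\boldsymbol\theta,\boldsymbol t)$ for which all the points $(\boldsymbol x,\boldsymbol y)$ involved lie in $\Omega$, the functions $\sigma_{m,n}$ are holomorphic in $\boldsymbol t$ and satisfy $$(t_i-t_j)\,\sigma_{m,n}\,\sigma_{m+1,n+1}(\theta_i+1,\theta_j+1)=t_i\,\sigma_{m+1,n}(\theta_i+1)\,\sigma_{m,n+1}(\theta_j+1)-t_j\,\sigma_{m+1,n}(\theta_j+1)\,\sigma_{m,n+1}(\theta_i+1),$$ $$(t_iD_i+\theta_i)\,\sigma_{m+1,n}\cdot\sigma_{m,n+1}=\theta_i\,\sigma_{m,n}(\theta_i-1)\,\sigma_{m+1,n+1}(\theta_i+1),$$ $$\bigl((t_j-t_i)D_i+\theta_i\bigr)\,\sigma_{m,n}(\theta_j-1)\cdot\sigma_{m+1,n}=\theta_i\,\sigma_{m,n}(\theta_i-1)\,\sigma_{m+1,n}(\theta_i+1,\theta_j-1),$$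 together with the homogeneity constraint $$\sum_{i=0}^N t_i\frac{\partial\sigma_{m,n}}{\partial t_i}=d_{m,n}\,\sigma_{m,n}.$$ -/

import Mathlib

open scoped ENNReal

namespace UCReduction

noncomputable section

/-- A pair `(x, y)` of sequences `x = (x₁, x₂, …)`, `y = (y₁, y₂, …)` of complex variables. -/
abbrev Times : Type := (ℕ+ → ℂ) × (ℕ+ → ℂ)

/-- The Banach space `ℓ¹ × ℓ¹` of pairs of absolutely summable sequences. -/
abbrev EllOne : Type := lp (fun _ : ℕ+ => ℂ) 1 × lp (fun _ : ℕ+ => ℂ) 1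

/-- The weighting `(u, v) ↦ (x, y)`, `x_n = Rⁿ u_n`, `y_n = r⁻ⁿ v_n`. For `r, R > 0` it identifies
`EllOne` with the weighted `ℓ¹` space of the pairs `(x, y)` such that
`∑ |x_n| R⁻ⁿ < ∞` and `∑ |y_n| rⁿ < ∞`. -/
def weighted (r R : ℝ) (u : EllOne) : Times :=
  (fun n => (R : ℂ) ^ (n : ℕ) * u.1 n, fun n => ((r : ℂ) ^ (n : ℕ))⁻¹ * u.2 n)

/-- The open annulus `a < |t| < b`; for `a = 0`, `b = ∞` it is the punctured plane. -/
def annulus (a b : ℝ≥0∞) : Set ℂ := {t | a < ‖t‖ₑ ∧ ‖t‖ₑ < b}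

/-- The admissible radii `(r, R)`: `r, R > 0`, `a < r` and `R < b`. -/
def Admissible (a b : ℝ≥0∞) (r R : ℝ) : Prop :=
  0 < r ∧ 0 < R ∧ a < ENNReal.ofReal r ∧ ENNReal.ofReal R < b

/-- The space of times: the union over all admissible radii of the weighted `ℓ¹` spaces, that is,
the pairs with `limsup |x_n|^(1/n) < b` and `limsup |y_n|^(1/n) < 1/a`. For `a = 0`, `b = ∞` these
are the pairs of sequences of at most exponential growth. -/
def timeSpace (a b : ℝ≥0∞) : Set Times :=
  {p | ∃ r R : ℝ, Admissible a b r R ∧ p ∈ Set.range (weighted r R)}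

/-- `Ω` is an open subset of the space of times (for the inductive limit topology): its trace on
each of the weighted `ℓ¹` spaces is open. -/
def IsOpenTimes (a b : ℝ≥0∞) (Ω : Set Times) : Prop :=
  Ω ⊆ timeSpace a b ∧ ∀ r R : ℝ, Admissible a b r R → IsOpen (weighted r R ⁻¹' Ω)

/-- `f` is holomorphic on `Ω`: it is complex (Fréchet) differentiable on the trace of `Ω` on each
of the weighted `ℓ¹` spaces. -/
def HolomorphicTimes (a b : ℝ≥0∞) (f : Times → ℂ) (Ω : Set Times) : Prop :=
  ∀ r R : ℝ, Admissible a b r R →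
    DifferentiableOn ℂ (fun u => f (weighted r R u)) (weighted r R ⁻¹' Ω)

/-- The partial derivative `∂f/∂x_n`. -/
def partialX (n : ℕ+) (f : Times → ℂ) (p : Times) : ℂ :=
  deriv (fun s : ℂ => f (Function.update p.1 n s, p.2)) (p.1 n)

/-- The partial derivative `∂f/∂y_n`. -/
def partialY (n : ℕ+) (f : Times → ℂ) (p : Times) : ℂ :=
  deriv (fun s : ℂ => f (p.1, Function.update p.2 n s)) (p.2 n)

/-- The vector field `δ_t = ∑ (tⁿ ∂/∂x_n - t⁻ⁿ ∂/∂y_n)`. -/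
def delta (t : ℂ) (f : Times → ℂ) (p : Times) : ℂ :=
  ∑' n : ℕ+, (t ^ (n : ℕ) * partialX n f p - (t ^ (n : ℕ))⁻¹ * partialY n f p)

/-- The Hirota derivative `D_{δ_t} f · g = (δ_t f) g - f (δ_t g)`. -/
def hirotaDelta (t : ℂ) (f g : Times → ℂ) (p : Times) : ℂ :=
  delta t f p * g p - f p * delta t g p

/-- The Euler operator `E = ∑ (n x_n ∂/∂x_n - n y_n ∂/∂y_n)`. -/
def euler (f : Times → ℂ) (p : Times) : ℂ :=
  ∑' n : ℕ+, ((n : ℂ) * p.1 n * partialX n f p - (n : ℂ) * p.2 n * partialY n f p)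

/-- The pair `([t], [t⁻¹])`, where `[t] = (t, t²/2, t³/3, …)`. -/
def miwa (t : ℂ) : Times :=
  (fun n => t ^ (n : ℕ) / (n : ℂ), fun n => t⁻¹ ^ (n : ℕ) / (n : ℂ))

/-- First bilinear equation, on `Ω`, for the sequence `τ`:
`(t-s) τ_{m,n}(x-[t]-[s], y-[t⁻¹]-[s⁻¹]) τ_{m+1,n+1}(x,y)`
`- t τ_{m,n+1}(x-[t], y-[t⁻¹]) τ_{m+1,n}(x-[s], y-[s⁻¹])`
`+ s τ_{m,n+1}(x-[s], y-[s⁻¹]) τ_{m+1,n}(x-[t], y-[t⁻¹]) = 0`. -/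
def BilinearA (a b : ℝ≥0∞) (Ω : Set Times) (τ : ℤ → ℤ → Times → ℂ) : Prop :=
  ∀ (m n : ℤ), ∀ t ∈ annulus a b, ∀ s ∈ annulus a b, ∀ p ∈ Ω,
    p - miwa t - miwa s ∈ Ω → p - miwa t ∈ Ω → p - miwa s ∈ Ω →
    (t - s) * τ m n (p - miwa t - miwa s) * τ (m + 1) (n + 1) p
      - t * τ m (n + 1) (p - miwa t) * τ (m + 1) n (p - miwa s)
      + s * τ m (n + 1) (p - miwa s) * τ (m + 1) n (p - miwa t) = 0

/-- Second bilinear equation, on `Ω`, for the sequence `τ`: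
`(D_{δ_t} - 1) τ_{m,n+1}(x,y) · τ_{m+1,n}(x,y)`
`+ τ_{m,n}(x-[t], y-[t⁻¹]) τ_{m+1,n+1}(x+[t], y+[t⁻¹]) = 0`. -/
def BilinearB (a b : ℝ≥0∞) (Ω : Set Times) (τ : ℤ → ℤ → Times → ℂ) : Prop :=
  ∀ (m n : ℤ), ∀ t ∈ annulus a b, ∀ p ∈ Ω, p - miwa t ∈ Ω → p + miwa t ∈ Ω →
    hirotaDelta t (τ m (n + 1)) (τ (m + 1) n) p - τ m (n + 1) p * τ (m + 1) n p
      + τ m n (p - miwa t) * τ (m + 1) (n + 1) (p + miwa t) = 0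

/-- Third bilinear equation, on `Ω`, for the sequence `τ`:
`(D_{δ_t} + t/(s-t)) τ_{m,n}(x-[s], y-[s⁻¹]) · τ_{m+1,n}(x,y)`
`+ t/(t-s) τ_{m,n}(x-[t], y-[t⁻¹]) τ_{m+1,n}(x+[t]-[s], y+[t⁻¹]-[s⁻¹]) = 0`. -/
def BilinearC (a b : ℝ≥0∞) (Ω : Set Times) (τ : ℤ → ℤ → Times → ℂ) : Prop :=
  ∀ (m n : ℤ), ∀ t ∈ annulus a b, ∀ s ∈ annulus a b, t ≠ s → ∀ p ∈ Ω,
    p - miwa s ∈ Ω → p - miwa t ∈ Ω → p + miwa t - miwa s ∈ Ω →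
    hirotaDelta t (fun q => τ m n (q - miwa s)) (τ (m + 1) n) p
      + t / (s - t) * (τ m n (p - miwa s) * τ (m + 1) n p)
      + t / (t - s) * (τ m n (p - miwa t) * τ (m + 1) n (p + miwa t - miwa s)) = 0

/-- Homogeneity on `Ω`: `E τ_{m,n} = d_{m,n} τ_{m,n}`. -/
def Homogeneous (Ω : Set Times) (τ : ℤ → ℤ → Times → ℂ) (d : ℤ → ℤ → ℂ) : Prop :=
  ∀ (m n : ℤ), ∀ p ∈ Ω, euler (τ m n) p = d m n * τ m n p

/-- Periodicity on `Ω`: `τ_{m+L,n} = τ_{m,n+L} = τ_{m,n}` up to nonzero constants. -/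
def PeriodicUpToConst (L : ℕ) (Ω : Set Times) (τ : ℤ → ℤ → Times → ℂ) : Prop :=
  ∀ (m n : ℤ),
    (∃ c : ℂ, c ≠ 0 ∧ ∀ p ∈ Ω, τ (m + L) n p = c * τ m n p) ∧
    (∃ c : ℂ, c ≠ 0 ∧ ∀ p ∈ Ω, τ m (n + L) p = c * τ m n p)

/-- The power sum substitution `x_n = (1/n) ∑ θ_i t_iⁿ`, `y_n = (1/n) ∑ θ_i t_i⁻ⁿ`, with `i` running
over `0, …, N`. -/
def powerSums {N : ℕ} (θ t : Fin (N + 1) → ℂ) : Times :=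
  (fun n => 1 / (n : ℂ) * ∑ i, θ i * t i ^ (n : ℕ),
   fun n => 1 / (n : ℂ) * ∑ i, θ i * (t i ^ (n : ℕ))⁻¹)

/-- `σ_{m,n}(θ, t) = τ_{m,n}(x, y)` under the power sum substitution. -/
def sigma {N : ℕ} (τ : ℤ → ℤ → Times → ℂ) (m n : ℤ) (θ t : Fin (N + 1) → ℂ) : ℂ :=
  τ m n (powerSums θ t)

/-- The unit vector `e_i`, so that `θ + e i` is `θ` with `θ_i` replaced by `θ_i + 1`. -/
def e {N : ℕ} (i : Fin (N + 1)) : Fin (N + 1) → ℂ := Pi.single i 1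

/-- The partial derivative `∂f/∂t_i`. -/
def partialT {N : ℕ} (i : Fin (N + 1)) (f : (Fin (N + 1) → ℂ) → ℂ) (t : Fin (N + 1) → ℂ) : ℂ :=
  deriv (fun s : ℂ => f (Function.update t i s)) (t i)

/-- The Hirota derivative `D_i f · g = (∂f/∂t_i) g - f (∂g/∂t_i)`. -/
def hirotaT {N : ℕ} (i : Fin (N + 1)) (f g : (Fin (N + 1) → ℂ) → ℂ) (t : Fin (N + 1) → ℂ) : ℂ :=
  partialT i f t * g t - f t * partialT i g t

end

end UCReduction

open UCReduction

namespace UCReduction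

noncomputable section

/-! Raising `θ_i` by one adds `([t_i], [t_i⁻¹])` to the power sums, so parameter shifts are the
shifts in the bilinear equations. Moreover `t_i ∂/∂t_i` sends `x_n` to `θ_i t_iⁿ` and `y_n` to `-θ_i
t_i⁻ⁿ`, so it acts as `θ_i δ_{t_i}`. Since `n x_n` and `n y_n` are the bare sums, `E = ∑ θ_i
δ_{t_i}`. The four identities are then specializations.

The analytic point is the chain rule in infinitely many variables. With `r < |t_i| < R` for all `i`,
the power sums lie in one weighted `ℓ¹` space and depend differentiably on `t`
(`hasFDerivAt_powerSumsCoord`). Continuity of the Fréchet derivative there sums the series for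
`δ_{t_i}` (`hasSum_delta`); `sigma_derivatives` joins the two. -/

/-! ### Power sequences in `ℓ¹`. -/

/-- The sequence `(w, w²/2, w³/3, …)`, as an element of `ℓ¹` for `|w| < 1`. -/
def powerSeq (w : ℂ) : lp (fun _ : ℕ+ => ℂ) 1 :=
  ∑' n : ℕ+, lp.single 1 n (w ^ (n : ℕ) / (n : ℂ))

/-- The sequence `(1, w, w², …)`, as an element of `ℓ¹` for `|w| < 1`. -/
def geomSeq (w : ℂ) : lp (fun _ : ℕ+ => ℂ) 1 :=
  ∑' n : ℕ+, lp.single 1 n (w ^ ((n : ℕ) - 1))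

theorem summable_pow_pnat_sub_one {ρ : ℝ} (h0 : 0 ≤ ρ) (h1 : ρ < 1) :
    Summable fun n : ℕ+ => ρ ^ ((n : ℕ) - 1) := by
  rw [← Equiv.pnatEquivNat.symm.summable_iff]
  simpa [Function.comp_def] using! summable_geometric_of_lt_one h0 h1

theorem summable_geomSeq {w : ℂ} (hw : ‖w‖ < 1) :
    Summable fun n : ℕ+ => (lp.single 1 n (w ^ ((n : ℕ) - 1)) : lp (fun _ : ℕ+ => ℂ) 1) := by
  refine Summable.of_norm_bounded (summable_pow_pnat_sub_one (norm_nonneg w) hw) fun n => ?_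
  rw [lp.norm_single one_pos, norm_pow]

theorem summable_powerSeq {w : ℂ} (hw : ‖w‖ < 1) :
    Summable fun n : ℕ+ => (lp.single 1 n (w ^ (n : ℕ) / (n : ℂ)) : lp (fun _ : ℕ+ => ℂ) 1) := by
  refine Summable.of_norm_bounded (summable_pow_pnat_sub_one (norm_nonneg w) hw) fun n => ?_
  rw [lp.norm_single one_pos, norm_div, norm_pow]
  have hn : (1 : ℝ) ≤ ‖((n : ℕ) : ℂ)‖ := by
    rw [Complex.norm_natCast]; exact_mod_cast n.pos
  refine (div_le_self (by positivity) hn).trans ?_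
  exact pow_le_pow_of_le_one (norm_nonneg w) hw.le (Nat.sub_le _ _)

theorem powerSeq_apply {w : ℂ} (hw : ‖w‖ < 1) (k : ℕ+) :
    powerSeq w k = w ^ (k : ℕ) / (k : ℂ) := by
  have h := (lp.evalCLM ℂ (fun _ : ℕ+ => ℂ) 1 k).map_tsum (summable_powerSeq hw)
  refine h.trans ((tsum_eq_single k fun n hn => ?_).trans ?_)
  · exact lp.single_apply_ne (E := fun _ : ℕ+ => ℂ) 1 n _ hn.symm
  · exact lp.single_apply_self (E := fun _ : ℕ+ => ℂ) 1 k _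

/-- `w d/dw` of the sequence of powers, coordinatewise. -/
theorem hasSum_smul_geomSeq {w : ℂ} (hw : ‖w‖ < 1) :
    HasSum (fun n : ℕ+ => (lp.single 1 n (w ^ (n : ℕ)) : lp (fun _ : ℕ+ => ℂ) 1))
      (w • geomSeq w) := by
  refine ((summable_geomSeq hw).hasSum.const_smul w).congr_fun fun n => ?_
  rw [← lp.single_smul, smul_eq_mul, mul_pow_sub_one n.ne_zero]

theorem hasDerivAt_single {g : ℂ → ℂ} {g' z : ℂ} (h : HasDerivAt g g' z) (n : ℕ+) :
    HasDerivAt (fun z => (lp.single 1 n (g z) : lp (fun _ : ℕ+ => ℂ) 1)) (lp.single 1 n g') z :=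
  (lp.singleContinuousLinearMap ℂ (fun _ : ℕ+ => ℂ) 1 n).hasFDerivAt.comp_hasDerivAt z h

/-- Termwise differentiation: on a ball of radius `ρ` with `|w| < ρ < 1` the derivatives are
dominated by `ρⁿ⁻¹`. -/
theorem hasDerivAt_powerSeq {w : ℂ} (hw : ‖w‖ < 1) :
    HasDerivAt powerSeq (geomSeq w) w := by
  obtain ⟨ρ, h1, h2⟩ := exists_between hw
  have hρ : 0 < ρ := (norm_nonneg w).trans_lt h1
  have hg : ∀ (n : ℕ+) (z : ℂ), HasDerivAt
      (fun z : ℂ => (lp.single 1 n (z ^ (n : ℕ) / (n : ℂ)) : lp (fun _ : ℕ+ => ℂ) 1))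
      (lp.single 1 n (z ^ ((n : ℕ) - 1))) z := by
    intro n z
    refine hasDerivAt_single ?_ n
    have hn : ((n : ℕ) : ℂ) ≠ 0 := by exact_mod_cast n.ne_zero
    have h := (hasDerivAt_pow (n : ℕ) z).div_const ((n : ℕ) : ℂ)
    rwa [mul_div_cancel_left₀ _ hn] at h
  have hg' : ∀ (n : ℕ+) (z : ℂ), z ∈ Metric.ball (0 : ℂ) ρ →
      ‖(lp.single 1 n (z ^ ((n : ℕ) - 1)) : lp (fun _ : ℕ+ => ℂ) 1)‖ ≤ ρ ^ ((n : ℕ) - 1) := by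
    intro n z hz
    rw [lp.norm_single one_pos, norm_pow]
    exact pow_le_pow_left₀ (norm_nonneg z) (mem_ball_zero_iff.1 hz).le _
  exact hasDerivAt_tsum_of_isPreconnected (summable_pow_pnat_sub_one hρ.le h2) Metric.isOpen_ball
    (convex_ball (0 : ℂ) ρ).isPreconnected (fun n z _ => hg n z) hg' (Metric.mem_ball_self hρ)
    (summable_powerSeq (by rw [norm_zero]; exact one_pos)) (mem_ball_zero_iff.2 h1)

/-! ### Weighted coordinates and partial derivatives. -/

/-- The coordinates in the weighted `ℓ¹` space of the power sums. -/
def powerSumsCoord {N : ℕ} (r R : ℝ) (θ t : Fin (N + 1) → ℂ) : EllOne :=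
  (∑ i, θ i • powerSeq (t i / R), ∑ i, θ i • powerSeq (r / t i))

theorem norm_div_lt_one_of_lt {R : ℝ} {z : ℂ} (h : ‖z‖ < R) : ‖z / (R : ℂ)‖ < 1 := by
  have hR : 0 < R := (norm_nonneg z).trans_lt h
  rwa [norm_div, Complex.norm_of_nonneg hR.le, div_lt_one hR]

theorem norm_div_lt_one_of_gt {r : ℝ} (hr : 0 < r) {z : ℂ} (h : r < ‖z‖) :
    ‖(r : ℂ) / z‖ < 1 := by
  rwa [norm_div, Complex.norm_of_nonneg hr.le, div_lt_one (hr.trans h)]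

theorem weighted_powerSumsCoord {N : ℕ} {r R : ℝ} (hr : 0 < r) (hR : 0 < R)
    (θ : Fin (N + 1) → ℂ) {t : Fin (N + 1) → ℂ} (ht : ∀ i, r < ‖t i‖ ∧ ‖t i‖ < R) :
    weighted r R (powerSumsCoord r R θ t) = powerSums θ t := by
  have hR' : (R : ℂ) ≠ 0 := by exact_mod_cast hR.ne'
  have hr' : (r : ℂ) ≠ 0 := by exact_mod_cast hr.ne'
  refine Prod.ext (funext fun n => ?_) (funext fun n => ?_)
  · simp only [weighted, powerSumsCoord, powerSums, lp.coeFn_sum, lp.coeFn_smul, Finset.sum_apply,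
      Pi.smul_apply, smul_eq_mul, Finset.mul_sum]
    refine Finset.sum_congr rfl fun i _ => ?_
    rw [powerSeq_apply (norm_div_lt_one_of_lt (ht i).2), div_pow]
    field_simp
  · simp only [weighted, powerSumsCoord, powerSums, lp.coeFn_sum, lp.coeFn_smul, Finset.sum_apply,
      Pi.smul_apply, smul_eq_mul, Finset.mul_sum]
    refine Finset.sum_congr rfl fun i _ => ?_
    rw [powerSeq_apply (norm_div_lt_one_of_gt hr (ht i).1), div_pow]
    field_simp

theorem update_eq_weighted_left {r R : ℝ} (hR : 0 < R) (u : EllOne) (n : ℕ+) (s : ℂ) :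
    (Function.update (weighted r R u).1 n s, (weighted r R u).2) =
      weighted r R (u + (lp.single 1 n (((R : ℂ) ^ (n : ℕ))⁻¹ * (s - (weighted r R u).1 n)), 0)) := by
  have hR' : (R : ℂ) ≠ 0 := by exact_mod_cast hR.ne'
  refine Prod.ext (funext fun k => ?_) (funext fun k => ?_)
  · rcases eq_or_ne k n with rfl | hk
    · simp [weighted, mul_add, hR']
    · simp [weighted, hk]
  · simp [weighted]

theorem update_eq_weighted_right {r R : ℝ} (hr : 0 < r) (u : EllOne) (n : ℕ+) (s : ℂ) :
    ((weighted r R u).1, Function.update (weighted r R u).2 n s) =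
      weighted r R (u + (0, lp.single 1 n ((r : ℂ) ^ (n : ℕ) * (s - (weighted r R u).2 n)))) := by
  have hr' : (r : ℂ) ≠ 0 := by exact_mod_cast hr.ne'
  refine Prod.ext (funext fun k => ?_) (funext fun k => ?_)
  · simp [weighted]
  · rcases eq_or_ne k n with rfl | hk
    · simp [weighted, mul_add, hr']
    · simp [weighted, hk]

/-- Moving `x_n` alone is an affine line in `EllOne` along the `n`-th basis vector, with speed `R⁻ⁿ`
because of the weight. -/
theorem partialX_weighted {f : Times → ℂ} {r R : ℝ} (hR : 0 < R) {u : EllOne}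
    {G' : EllOne →L[ℂ] ℂ} (hf : HasFDerivAt (fun u => f (weighted r R u)) G' u) (n : ℕ+) :
    partialX n f (weighted r R u) = ((R : ℂ) ^ (n : ℕ))⁻¹ * G' (lp.single 1 n 1, 0) := by
  unfold partialX
  simp only [update_eq_weighted_left hR]
  set c := (weighted r R u).1 n
  have h1 : HasDerivAt (fun s : ℂ => ((R : ℂ) ^ (n : ℕ))⁻¹ * (s - c)) ((R : ℂ) ^ (n : ℕ))⁻¹ c := by
    simpa using ((hasDerivAt_id c).sub_const c).const_mul ((R : ℂ) ^ (n : ℕ))⁻¹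
  have h2 := hasDerivAt_single h1 n
  have h3 := (h2.prodMk (hasDerivAt_const c (0 : lp (fun _ : ℕ+ => ℂ) 1))).const_add u
  have h4 := HasFDerivAt.comp_hasDerivAt c (l := fun u => f (weighted r R u)) (l' := G')
    (by simpa [← Prod.zero_eq_mk] using hf) h3
  refine h4.deriv.trans ?_
  rw [← smul_eq_mul, ← map_smul]
  congr 1
  refine Prod.ext ?_ (by simp)
  simp [← lp.single_smul]

theorem partialY_weighted {f : Times → ℂ} {r R : ℝ} (hr : 0 < r) {u : EllOne}
    {G' : EllOne →L[ℂ] ℂ} (hf : HasFDerivAt (fun u => f (weighted r R u)) G' u) (n : ℕ+) :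
    partialY n f (weighted r R u) = (r : ℂ) ^ (n : ℕ) * G' (0, lp.single 1 n 1) := by
  unfold partialY
  simp only [update_eq_weighted_right hr]
  set c := (weighted r R u).2 n
  have h1 : HasDerivAt (fun s : ℂ => (r : ℂ) ^ (n : ℕ) * (s - c)) ((r : ℂ) ^ (n : ℕ)) c := by
    simpa using ((hasDerivAt_id c).sub_const c).const_mul ((r : ℂ) ^ (n : ℕ))
  have h2 := hasDerivAt_single h1 n
  have h3 := ((hasDerivAt_const c (0 : lp (fun _ : ℕ+ => ℂ) 1)).prodMk h2).const_add u
  have h4 := HasFDerivAt.comp_hasDerivAt c (l := fun u => f (weighted r R u)) (l' := G')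
    (by simpa [← Prod.zero_eq_mk] using hf) h3
  refine h4.deriv.trans ?_
  rw [← smul_eq_mul, ← map_smul]
  congr 1
  refine Prod.ext (by simp) ?_
  simp [← lp.single_smul]

/-- The series of the vector field `δ_t` converges to the Fréchet derivative in the direction
`(tⁿ R⁻ⁿ, -t⁻ⁿ rⁿ)`. -/
theorem hasSum_delta {f : Times → ℂ} {r R : ℝ} (hr : 0 < r) (hR : 0 < R) {u : EllOne}
    {G' : EllOne →L[ℂ] ℂ} (hf : HasFDerivAt (fun u => f (weighted r R u)) G' u)
    {t : ℂ} (htr : r < ‖t‖) (htR : ‖t‖ < R) :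
    HasSum (fun n : ℕ+ => t ^ (n : ℕ) * partialX n f (weighted r R u)
        - (t ^ (n : ℕ))⁻¹ * partialY n f (weighted r R u))
      (G' ((t / R) • geomSeq (t / R), -((r / t) • geomSeq (r / t)))) := by
  have h := ((hasSum_smul_geomSeq (norm_div_lt_one_of_lt htR)).prodMk
    (hasSum_smul_geomSeq (norm_div_lt_one_of_gt hr htr)).neg).mapL G'
  refine h.congr_fun fun n => ?_
  have hs : ∀ c d : ℂ, G' (lp.single 1 n c, -lp.single 1 n d) =
      c * G' (lp.single 1 n 1, 0) - d * G' (0, lp.single 1 n 1) := by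
    intro c d
    rw [← smul_eq_mul, ← smul_eq_mul, ← map_smul, ← map_smul, ← map_sub]
    congr 1
    refine Prod.ext ?_ ?_ <;> simp [← lp.single_smul]
  rw [partialX_weighted hR hf, partialY_weighted hr hf, hs, div_pow, div_pow]
  ring

/-! ### The chain rule in `t`. -/

theorem exists_admissible {N : ℕ} {a b : ℝ≥0∞} {t : Fin (N + 1) → ℂ}
    (ht : ∀ i, t i ∈ annulus a b) :
    ∃ r R : ℝ, Admissible a b r R ∧ ∀ i, r < ‖t i‖ ∧ ‖t i‖ < R := by
  obtain ⟨i₀, hi₀⟩ := Finite.exists_min fun i => ‖t i‖ₑ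
  obtain ⟨i₁, hi₁⟩ := Finite.exists_max fun i => ‖t i‖ₑ
  obtain ⟨r, hr1, hr2⟩ := ENNReal.lt_iff_exists_nnreal_btwn.1 (ht i₀).1
  obtain ⟨R, hR1, hR2⟩ := ENNReal.lt_iff_exists_nnreal_btwn.1 (ht i₁).2
  have hr0 : 0 < r := by exact_mod_cast (zero_le (a := a)).trans_lt hr1
  have hlt : ∀ i, (r : ℝ) < ‖t i‖ ∧ ‖t i‖ < R := fun i =>
    ⟨by exact_mod_cast (hr2.trans_le (hi₀ i) : (r : ℝ≥0∞) < (‖t i‖₊ : ℝ≥0∞)), by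
      exact_mod_cast ((hi₁ i).trans_lt hR1 : (‖t i‖₊ : ℝ≥0∞) < (R : ℝ≥0∞))⟩
  exact ⟨r, R, ⟨hr0, (norm_nonneg _).trans_lt (hlt i₀).2, by simpa using hr1, by simpa using hR2⟩,
    hlt⟩

/-- The right-hand side is `θ_i` times the direction in `hasSum_delta`; its minus sign comes from
differentiating `r / t_i`. -/
theorem hasFDerivAt_powerSumsCoord {N : ℕ} {r R : ℝ} (hr : 0 < r) (θ : Fin (N + 1) → ℂ)
    {t : Fin (N + 1) → ℂ} (ht : ∀ i, r < ‖t i‖ ∧ ‖t i‖ < R) :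
    ∃ U' : (Fin (N + 1) → ℂ) →L[ℂ] EllOne, HasFDerivAt (powerSumsCoord r R θ) U' t ∧
      ∀ i, t i • U' (Pi.single i 1) =
        θ i • ((t i / R) • geomSeq (t i / R), -((r / t i) • geomSeq (r / t i))) := by
  have ht0 : ∀ i, t i ≠ 0 := fun i => norm_pos_iff.1 (hr.trans (ht i).1)
  have h1 : ∀ i, HasDerivAt (fun z : ℂ => powerSeq (z / R)) ((1 / (R : ℂ)) • geomSeq (t i / R))
      (t i) := fun i =>
    HasDerivAt.scomp (g₁ := powerSeq) (h := fun z : ℂ => z / R) (t i)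
      (hasDerivAt_powerSeq (norm_div_lt_one_of_lt (ht i).2))
      ((hasDerivAt_id (t i)).div_const (R : ℂ))
  have h2 : ∀ i, HasDerivAt (fun z : ℂ => powerSeq (r / z))
      ((r * -(t i ^ 2)⁻¹) • geomSeq (r / t i)) (t i) := fun i =>
    HasDerivAt.scomp (g₁ := powerSeq) (h := fun z : ℂ => r / z) (t i)
      (hasDerivAt_powerSeq (norm_div_lt_one_of_gt hr (ht i).1))
      (by simpa only [div_eq_mul_inv] using (hasDerivAt_inv (ht0 i)).const_mul (r : ℂ))
  have h1' := HasFDerivAt.fun_sum (u := Finset.univ) fun i _ =>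
    (HasFDerivAt.comp (g := fun z : ℂ => powerSeq (z / R)) (f := fun t : Fin (N + 1) → ℂ => t i) t
      (h1 i).hasFDerivAt (hasFDerivAt_apply i t)).const_smul (θ i)
  have h2' := HasFDerivAt.fun_sum (u := Finset.univ) fun i _ =>
    (HasFDerivAt.comp (g := fun z : ℂ => powerSeq (r / z)) (f := fun t : Fin (N + 1) → ℂ => t i) t
      (h2 i).hasFDerivAt (hasFDerivAt_apply i t)).const_smul (θ i)
  refine ⟨_, h1'.prodMk h2', fun i => ?_⟩
  have hs : ∀ (c : Fin (N + 1) → lp (fun _ : ℕ+ => ℂ) 1),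
      ∑ j, θ j • (Pi.single i 1 : Fin (N + 1) → ℂ) j • c j = θ i • c i := by
    intro c
    rw [Finset.sum_eq_single i] <;> simp +contextual
  refine Prod.ext ?_ ?_
  · simp [hs]
    rw [smul_comm, smul_smul (t i)]
    rfl
  · simp [hs]
    rw [smul_comm, smul_smul (t i)]
    congr 2
    have := ht0 i
    field_simp

/-- Under the power sum substitution, `σ` is holomorphic in `t`, and `t_i ∂/∂t_i` acts as
`θ_i δ_{t_i}`, where the series of `δ_{t_i}` converges. -/
theorem sigma_derivatives {N : ℕ} {a b : ℝ≥0∞} {Ω : Set Times} (hΩ : IsOpenTimes a b Ω)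
    {f : Times → ℂ} (hf : HolomorphicTimes a b f Ω) {θ t : Fin (N + 1) → ℂ}
    (ht : ∀ i, t i ∈ annulus a b) (hp : powerSums θ t ∈ Ω) :
    DifferentiableAt ℂ (fun t => f (powerSums θ t)) t ∧
      ∀ i, t i * partialT i (fun t => f (powerSums θ t)) t =
          θ i * delta (t i) f (powerSums θ t) ∧
        Summable fun n : ℕ+ => t i ^ (n : ℕ) * partialX n f (powerSums θ t)
          - (t i ^ (n : ℕ))⁻¹ * partialY n f (powerSums θ t) := by
  obtain ⟨r, R, hadm, hlt⟩ := exists_admissible ht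
  have hr := hadm.1
  have hR := hadm.2.1
  have hw := weighted_powerSumsCoord hr hR θ hlt
  have hG := ((hf r R hadm).differentiableAt
    ((hΩ.2 r R hadm).mem_nhds (show weighted r R (powerSumsCoord r R θ t) ∈ Ω from hw ▸ hp))
    ).hasFDerivAt
  obtain ⟨U', hU, hU'⟩ := hasFDerivAt_powerSumsCoord hr θ hlt
  -- The weighted coordinates represent the power sums only while every `|t_i|` stays between `r`
  -- and `R`, an open condition.
  have hnear : (fun t => f (powerSums θ t)) =ᶠ[nhds t]
      fun t => f (weighted r R (powerSumsCoord r R θ t)) := by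
    have hev : ∀ᶠ t' in nhds t, ∀ i, r < ‖t' i‖ ∧ ‖t' i‖ < R := by
      refine Filter.eventually_all.2 fun i => ?_
      have hc : ContinuousAt (fun t' : Fin (N + 1) → ℂ => ‖t' i‖) t :=
        (continuous_apply i).norm.continuousAt
      exact (hc.eventually (lt_mem_nhds (hlt i).1)).and (hc.eventually (gt_mem_nhds (hlt i).2))
    filter_upwards [hev] with t' h'
    rw [weighted_powerSumsCoord hr hR θ h']
  have hσ := (hG.comp t hU).congr_of_eventuallyEq hnear
  refine ⟨hσ.differentiableAt, fun i => ?_⟩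
  have hsum := hasSum_delta hr hR hG (hlt i).1 (hlt i).2
  rw [hw] at hsum
  refine ⟨?_, hsum.summable⟩
  have hd : partialT i (fun t => f (powerSums θ t)) t = _ :=
    (HasFDerivAt.comp_hasDerivAt (t i) (l := fun t => f (powerSums θ t)) (by simpa using hσ)
      (hasDerivAt_update t i (t i))).deriv
  rw [hd, delta, hsum.tsum_eq, ← smul_eq_mul, ← smul_eq_mul, ← map_smul, ← map_smul, ← hU' i]
  simp

/-! ### Translations, parameter shifts and the Euler operator. -/

/-- The coefficients of `δ_t` are constant in `(x, y)`, and `deriv` commutes with translation even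
without differentiability. -/
theorem delta_comp_sub (t : ℂ) (f : Times → ℂ) (p q : Times) :
    delta t (fun z => f (z - q)) p = delta t f (p - q) := by
  have hX : ∀ n, partialX n (fun z => f (z - q)) p = partialX n f (p - q) := by
    intro n
    have h : (fun s : ℂ => f ((Function.update p.1 n s, p.2) - q)) =
        fun s => (fun s => f (Function.update (p - q).1 n s, (p - q).2)) (s - q.1 n) := by
      funext s
      congr 1
      refine Prod.ext (funext fun k => ?_) rfl
      rcases eq_or_ne k n with rfl | hk
      · simp
      · simp [hk]
    unfold partialX
    rw [h]
    exact deriv_comp_sub_const (fun s => f (Function.update (p - q).1 n s, (p - q).2)) _ _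
  have hY : ∀ n, partialY n (fun z => f (z - q)) p = partialY n f (p - q) := by
    intro n
    have h : (fun s : ℂ => f ((p.1, Function.update p.2 n s) - q)) =
        fun s => (fun s => f ((p - q).1, Function.update (p - q).2 n s)) (s - q.2 n) := by
      funext s
      congr 1
      refine Prod.ext rfl (funext fun k => ?_)
      rcases eq_or_ne k n with rfl | hk
      · simp
      · simp [hk]
    unfold partialY
    rw [h]
    exact deriv_comp_sub_const (fun s => f ((p - q).1, Function.update (p - q).2 n s)) _ _
  simp only [delta, hX, hY]

theorem powerSums_add {N : ℕ} (θ θ' t : Fin (N + 1) → ℂ) :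
    powerSums (θ + θ') t = powerSums θ t + powerSums θ' t := by
  refine Prod.ext (funext fun n => ?_) (funext fun n => ?_) <;>
    simp [powerSums, add_mul, Finset.sum_add_distrib, mul_add]

theorem powerSums_e {N : ℕ} (i : Fin (N + 1)) (t : Fin (N + 1) → ℂ) :
    powerSums (e i) t = miwa (t i) := by
  refine Prod.ext (funext fun n => ?_) (funext fun n => ?_) <;>
    simp [powerSums, e, miwa, Pi.single_apply, div_eq_inv_mul]

theorem powerSums_add_e {N : ℕ} (θ t : Fin (N + 1) → ℂ) (i : Fin (N + 1)) :
    powerSums (θ + e i) t = powerSums θ t + miwa (t i) := by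
  rw [powerSums_add, powerSums_e]

theorem powerSums_sub_e {N : ℕ} (θ t : Fin (N + 1) → ℂ) (i : Fin (N + 1)) :
    powerSums (θ - e i) t = powerSums θ t - miwa (t i) := by
  rw [eq_sub_iff_add_eq, ← powerSums_add_e, sub_add_cancel]

/-- Summability for each `i` allows the finite sum over `i` to be exchanged with the series over
`n`. -/
theorem euler_powerSums {N : ℕ} {f : Times → ℂ} {θ t : Fin (N + 1) → ℂ}
    (hs : ∀ i, Summable fun n : ℕ+ => t i ^ (n : ℕ) * partialX n f (powerSums θ t)
      - (t i ^ (n : ℕ))⁻¹ * partialY n f (powerSums θ t)) :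
    euler f (powerSums θ t) = ∑ i, θ i * delta (t i) f (powerSums θ t) := by
  have h := (hasSum_sum (s := Finset.univ) fun i _ => (hs i).hasSum.mul_left (θ i)).tsum_eq
  refine Eq.trans ?_ h
  unfold euler
  congr 1
  funext n
  have hn : ((n : ℕ) : ℂ) ≠ 0 := by exact_mod_cast n.ne_zero
  have hx : (n : ℂ) * (powerSums θ t).1 n = ∑ i, θ i * t i ^ (n : ℕ) := by
    simp only [powerSums]; field_simp
  have hy : (n : ℂ) * (powerSums θ t).2 n = ∑ i, θ i * (t i ^ (n : ℕ))⁻¹ := by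
    simp only [powerSums]; field_simp
  rw [hx, hy, Finset.sum_mul, Finset.sum_mul, ← Finset.sum_sub_distrib]
  exact Finset.sum_congr rfl fun i _ => by ring

end

end UCReduction

/-! ### The reduced equations. -/

theorem mainTheorem7 (L N : ℕ) (hL : 2 ≤ L) (hN : 1 ≤ N)
    (a b : ℝ≥0∞) (Ω : Set Times) (hΩ : IsOpenTimes a b Ω)
    (τ : ℤ → ℤ → Times → ℂ) (d : ℤ → ℤ → ℂ)
    (hτ : ∀ m n, HolomorphicTimes a b (τ m n) Ω)
    (hA : BilinearA a b Ω τ) (hB : BilinearB a b Ω τ) (hC : BilinearC a b Ω τ)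
    (hhom : Homogeneous Ω τ d) (hper : PeriodicUpToConst L Ω τ)
    (m n : ℤ) (θ t : Fin (N + 1) → ℂ) (ht : ∀ i, t i ∈ annulus a b) :
    -- the functions are holomorphic in `t`
    (powerSums θ t ∈ Ω → DifferentiableAt ℂ (sigma τ m n θ) t) ∧
    -- first bilinear equation
    (∀ i j,
      powerSums θ t ∈ Ω → powerSums (θ + e i + e j) t ∈ Ω →
      powerSums (θ + e i) t ∈ Ω → powerSums (θ + e j) t ∈ Ω →
      (t i - t j) * (sigma τ m n θ t * sigma τ (m + 1) (n + 1) (θ + e i + e j) t) =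
        t i * sigma τ (m + 1) n (θ + e i) t * sigma τ m (n + 1) (θ + e j) t
          - t j * sigma τ (m + 1) n (θ + e j) t * sigma τ m (n + 1) (θ + e i) t) ∧
    -- second bilinear equation
    (∀ i,
      powerSums θ t ∈ Ω → powerSums (θ - e i) t ∈ Ω → powerSums (θ + e i) t ∈ Ω →
      t i * hirotaT i (sigma τ (m + 1) n θ) (sigma τ m (n + 1) θ) t
          + θ i * (sigma τ (m + 1) n θ t * sigma τ m (n + 1) θ t) =
        θ i * (sigma τ m n (θ - e i) t * sigma τ (m + 1) (n + 1) (θ + e i) t)) ∧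
    -- third bilinear equation
    (∀ i j,
      powerSums θ t ∈ Ω → powerSums (θ - e j) t ∈ Ω →
      powerSums (θ - e i) t ∈ Ω → powerSums (θ + e i - e j) t ∈ Ω →
      (t j - t i) * hirotaT i (sigma τ m n (θ - e j)) (sigma τ (m + 1) n θ) t
          + θ i * (sigma τ m n (θ - e j) t * sigma τ (m + 1) n θ t) =
        θ i * (sigma τ m n (θ - e i) t * sigma τ (m + 1) n (θ + e i - e j) t)) ∧
    -- homogeneity constraint
    (powerSums θ t ∈ Ω →
      ∑ i, t i * partialT i (sigma τ m n θ) t = d m n * sigma τ m n θ t) := by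
  have ht0 : ∀ i, t i ≠ 0 := fun i => by
    have h : (0 : ℝ≥0∞) < ‖t i‖ₑ := (zero_le (a := a)).trans_lt (ht i).1
    simpa using h.ne'
  refine ⟨fun h => (sigma_derivatives hΩ (hτ m n) ht h).1, ?_, ?_, ?_, ?_⟩
  · intro i j h hij hi hj
    -- Equation (a) only shifts backwards, so its base point is `θ + e i + e j`.
    have e1 : powerSums (θ + e i + e j) t - miwa (t i) = powerSums (θ + e j) t := by
      simp only [powerSums_add_e]; abel
    have e2 : powerSums (θ + e i + e j) t - miwa (t j) = powerSums (θ + e i) t := by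
      simp only [powerSums_add_e]; abel
    have e3 : powerSums (θ + e i + e j) t - miwa (t i) - miwa (t j) = powerSums θ t := by
      simp only [powerSums_add_e]; abel
    have key := hA m n (t i) (ht i) (t j) (ht j) _ hij (e3 ▸ h) (e1 ▸ hj) (e2 ▸ hi)
    rw [e1, e2] at key
    rw [show powerSums (θ + e j) t - miwa (t j) = powerSums θ t by rw [← e1, e3]] at key
    simp only [sigma]
    linear_combination key
  · intro i h hm hp
    have key := hB m n (t i) (ht i) _ h (powerSums_sub_e θ t i ▸ hm) (powerSums_add_e θ t i ▸ hp)
    have d1 := ((sigma_derivatives hΩ (hτ (m + 1) n) ht h).2 i).1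
    have d2 := ((sigma_derivatives hΩ (hτ m (n + 1)) ht h).2 i).1
    rw [← powerSums_sub_e, ← powerSums_add_e] at key
    simp only [hirotaDelta] at key
    simp only [hirotaT, sigma]
    change t i * partialT i (sigma τ (m + 1) n θ) t = _ at d1
    change t i * partialT i (sigma τ m (n + 1) θ) t = _ at d2
    -- The factors in (b) come in the opposite order; antisymmetry of the Hirota derivative gives
    -- the sign.
    linear_combination (-θ i) * key + τ m (n + 1) (powerSums θ t) * d1
      - τ (m + 1) n (powerSums θ t) * d2
  · intro i j h hj hi hij
    -- Equation (c) excludes `t = s`; there the derivative term vanishes and the two sides coincide.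
    -- This includes `i = j`.
    by_cases hne : t i = t j
    · have e1 : powerSums (θ - e j) t = powerSums (θ - e i) t := by
        simp only [powerSums_sub_e, hne]
      have e2 : powerSums (θ + e i - e j) t = powerSums θ t := by
        simp only [powerSums_sub_e, powerSums_add_e, hne]; abel
      simp only [sigma, e1, e2, hne]
      ring
    · have hne' : t j - t i ≠ 0 := sub_ne_zero.2 (Ne.symm hne)
      have hne'' : t i - t j ≠ 0 := sub_ne_zero.2 hne
      have e2 : powerSums (θ + e i - e j) t = powerSums θ t + miwa (t i) - miwa (t j) := by
        simp only [powerSums_sub_e, powerSums_add_e]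
      have key := hC m n (t i) (ht i) (t j) (ht j) hne _ h (powerSums_sub_e θ t j ▸ hj)
        (powerSums_sub_e θ t i ▸ hi) (e2 ▸ hij)
      have d1 := ((sigma_derivatives hΩ (hτ (m + 1) n) ht h).2 i).1
      have d2 := ((sigma_derivatives hΩ (hτ m n) ht hj).2 i).1
      rw [hirotaDelta, delta_comp_sub, ← e2, ← powerSums_sub_e, ← powerSums_sub_e] at key
      simp only [hirotaT]
      change t i * partialT i (sigma τ (m + 1) n θ) t = _ at d1
      change t i * partialT i (sigma τ m n (θ - e j)) t = _ at d2
      -- Distinct `t i`, `t j` force `i ≠ j`, so the shift leaves the factor `θ i` in `d2`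
      -- unchanged.
      have hθ : (θ - e j : Fin (N + 1) → ℂ) i = θ i := by
        have hij : i ≠ j := fun h => hne (congrArg t h)
        simp [e, hij]
      rw [hθ] at d2
      have hs : t i / (t j - t i) = - (t i / (t i - t j)) := by
        rw [← neg_sub (t i) (t j), div_neg]
      have hq : t i / (t i - t j) * (t j - t i) = - t i := by
        field_simp; ring
      rw [hs] at key
      -- The chain rule gives `t_i ∂/∂t_i`, while the goal has a bare `∂/∂t_i`.
      refine mul_left_cancel₀ (ht0 i) ?_
      simp only [sigma] at *
      linear_combination (θ i * (t j - t i)) * key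
        + (t j - t i) * τ (m + 1) n (powerSums θ t) * d2
        - (t j - t i) * τ m n (powerSums (θ - e j) t) * d1
        + θ i * (τ m n (powerSums (θ - e j) t) * τ (m + 1) n (powerSums θ t)
          - τ m n (powerSums (θ - e i) t) * τ (m + 1) n (powerSums (θ + e i - e j) t)) * hq
  · intro h
    have hd := (sigma_derivatives hΩ (hτ m n) ht h).2
    rw [sigma, ← hhom m n _ h, euler_powerSums fun i => (hd i).2]
    exact Finset.sum_congr rfl fun i _ => (hd i).1
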